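/- Let $\mu$ be normalized arclength measure on the unit circle $\mathbb T$, let $\chi(z)=z$, write $f^*$ for the complex conjugate $\overline f$ of a function $f$ on $\mathbb T$, and let $H^2\subset L^2(\mathbb T)$ be the Hardy space, that is, the space of $f\in L^2(\mathbb T)$ whose Fourier coefficients $\widehat f(n)$ vanish for $n<0$. For $g\in H^2$, $g(0)$ and $g'(0)$ denote the values at $0$ of the analytic function $\sum_{n\ge 0}\widehat g(n)z^n$ on the disc and of its derivative. A function $g\in H^2$ is *outer* if $\{ag : a\in A(\mathbb D)\}$ is dense in $H^2$, where $A(\mathbb D)$ is the disc algebra (functions continuous on the closed unit disc and analytic in its interior). For a linear subspace $\mathcal V\subset\mathbb C\oplus\mathbb Cz$ put $H^2_{\mathcal V}=H^2\ominus\mathcal V=\{f\in H^2 : f\perp\mathcal V\}$, and for a real-valued $\varphi\in L^\infty(\mathbb T)$ let $T^{\mathcal V}_\varphi f=P_{\mathcal V}(\varphi f)$ for $f\in H^2_{\mathcal V}$, where $P_{\mathcal V}$ is the orthogonal projection of $L^2(\mathbb T)$ onto $H^2_{\mathcal V}$. **Theorem.** Let $\varphi\in L^\infty(\mathbb T)$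 be real-valued and not almost everywhere zero. 1. Let $\mathcal V\subset\mathbb C\oplus\mathbb Cz$ be a subspace and let $g\in H^2_{\mathcal V}$ be nonzero. If $T^{\mathcal V}_\varphi g=0$, then $g$ is outer and there is a $c\in\mathbb C$ such that $$\varphi|g|^2=c\chi+(c\chi)^*\quad\text{almost everywhere on }\mathbb T.\tag{1}$$ 2. Conversely, let $c\in\mathbb C$ and let $g\in H^2$ be an outer function such that (1) holds. Then there is exactly one subspace $\mathcal V\subset\mathbb C\oplus\mathbb Cz$ such that $g\in H^2_{\mathcal V}$ and $T^{\mathcal V}_\varphi g=0$, and it is determined by $g(0)$ and $g'(0)$: it is the orthogonal complement in $\mathbb C\oplus\mathbb Cz$ of the vector $g(0)+g'(0)z$. 3. There is at most one subspace $\mathcal V\subset\mathbb C\oplus\mathbb Cz$ such that $T^{\mathcal V}_\varphi$ has eigenvalue $0$, and for every $\mathcal V$ the kernel of $T^{\mathcal V}_\varphi$ has dimension at most one. -/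

import Mathlib

noncomputable section

namespace NeilToeplitz

open MeasureTheory
open scoped ENNReal ComplexConjugate

/-- Normalized arclength measure on the unit circle `𝕋`. The circle is parametrized by
`x ∈ ℝ / ℤ` through `x ↦ exp (2 π i x)`, which is `AddCircle.toCircle`. -/
abbrev arc : Measure UnitAddCircle := AddCircle.haarAddCircle

/-- The coordinate function `χ(z) = z` on the circle. -/
def chi (x : UnitAddCircle) : ℂ := (AddCircle.toCircle x : ℂ)

/-- The Hilbert space `L²(𝕋)`. -/
abbrev L2 : Type := Lp ℂ 2 arc

/-- The space of real-valued functions in `L^∞(𝕋)`. -/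
abbrev RealLinf : Type := Lp ℝ ∞ arc

theorem fourierCoeff_eq_inner (f : L2) (n : ℤ) :
    fourierCoeff f n = inner ℂ (fourierLp (T := 1) 2 n) f := by
  rw [← fourierBasis_repr, HilbertBasis.repr_apply_apply, coe_fourierBasis]

/-- The Hardy space `H²`, as a subspace of `L²(𝕋)`: the functions whose Fourier coefficients
of negative index vanish. -/
def H2 : Submodule ℂ L2 where
  carrier := {f | ∀ n : ℤ, n < 0 → fourierCoeff f n = 0}
  zero_mem' := by
    intro n _
    rw [fourierCoeff_eq_inner, inner_zero_right]
  add_mem' := by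
    intro f g hf hg n hn
    rw [fourierCoeff_eq_inner, inner_add_right, ← fourierCoeff_eq_inner,
      ← fourierCoeff_eq_inner, hf n hn, hg n hn, add_zero]
  smul_mem' := by
    intro c f hf n hn
    rw [fourierCoeff_eq_inner, inner_smul_right, ← fourierCoeff_eq_inner, hf n hn, mul_zero]

theorem isClosed_H2 : IsClosed (H2 : Set L2) := by
  have h : (H2 : Set L2) =
      ⋂ (n : ℤ) (_ : n < 0), {f : L2 | inner ℂ (fourierLp (T := 1) 2 n) f = 0} := by
    ext f
    simp only [Set.mem_iInter, Set.mem_ofPred_eq, ← fourierCoeff_eq_inner]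
    rfl
  rw [h]
  refine isClosed_iInter fun n => isClosed_iInter fun _ => ?_
  exact isClosed_eq (continuous_const.inner continuous_id) continuous_const

/-- The analytic function on the unit disc given by the Taylor series
`∑ f̂(n) zⁿ`, `n ≥ 0`. For `f ∈ H²` this is the function on the disc with boundary values `f`. -/
def toDisc (f : L2) (z : ℂ) : ℂ := ∑' n : ℕ, fourierCoeff f (n : ℤ) * z ^ n

/-- The two-dimensional space `ℂ ⊕ ℂ z ⊆ L²(𝕋)` spanned by the functions `1` and `z`. -/
def affinePolys : Submodule ℂ L2 :=
  Submodule.span ℂ {fourierLp (T := 1) 2 0, fourierLp (T := 1) 2 1}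

/-- `H²_𝒱 = H² ⊖ 𝒱`, the functions in `H²` that are orthogonal to `𝒱`. -/
def H2V (V : Submodule ℂ L2) : Submodule ℂ L2 := H2 ⊓ Vᗮ

instance completeSpace_H2V (V : Submodule ℂ L2) : CompleteSpace (H2V V) :=
  (isClosed_H2.inter V.isClosed_orthogonal).completeSpace_coe

theorem mul_smul_L2 (φ : RealLinf) (c : ℂ) (f : L2) :
    (φ • (c • f) : L2) = c • (φ • f : L2) := by
  apply Lp.ext
  filter_upwards [Lp.coeFn_lpSMul (r := 2) φ (c • f), Lp.coeFn_lpSMul (r := 2) φ f,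
    Lp.coeFn_smul c f, Lp.coeFn_smul c (φ • f : L2)] with x h1 h2 h3 h4
  rw [h1, h4, Pi.smul_apply', h3, Pi.smul_apply, Pi.smul_apply, h2, Pi.smul_apply', smul_comm]

/-- The Toeplitz operator `f ↦ P_𝒱 (φ f)` on `H²_𝒱`, where `P_𝒱` is the orthogonal projection of
`L²(𝕋)` onto `H²_𝒱`. -/
def toeplitz (φ : RealLinf) (V : Submodule ℂ L2) : H2V V →ₗ[ℂ] H2V V where
  toFun f := (H2V V).orthogonalProjectionOnto (φ • (f : L2) : L2)
  map_add' f g := by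
    rw [Submodule.coe_add, Lp.add_smul, map_add]
  map_smul' c f := by
    rw [Submodule.coe_smul, RingHom.id_apply, mul_smul_L2, map_smul]

/-- `f ∈ L²(𝕋)` agrees almost everywhere with `a g` for some `a` in the disc algebra `A(𝔻)`
(continuous on the closed unit disc and analytic in its interior). -/
def IsDiscAlgebraMultiple (g f : L2) : Prop :=
  ∃ a : ℂ → ℂ, DiffContOnCl ℂ a (Metric.ball 0 1) ∧ ∀ᵐ x ∂arc, f x = a (chi x) * g x

/-- `g ∈ H²` is outer if `{a g : a ∈ A(𝔻)}` is dense in the Hilbert space `H²`. -/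
def IsOuter (g : L2) : Prop :=
  g ∈ H2 ∧ closure {f : L2 | IsDiscAlgebraMultiple g f} = (H2 : Set L2)

/-- The identity `φ |g|² = c χ + (c χ)^*` almost everywhere on the circle. -/
def ModulusIdentity (φ : RealLinf) (g : L2) (c : ℂ) : Prop :=
  ∀ᵐ x ∂arc, ((φ x * ‖g x‖ ^ 2 : ℝ) : ℂ) = c * chi x + conj (c * chi x)

/-- The subspace of `ℂ ⊕ ℂ z` determined by two values `g(0) = w₀` and `g'(0) = w₁`: the orthogonal
complement of `w₀ + w₁ z` in `ℂ ⊕ ℂ z`. -/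
def determinedSpace (w₀ w₁ : ℂ) : Submodule ℂ L2 :=
  affinePolys ⊓ (Submodule.span ℂ {w₀ • fourierLp (T := 1) 2 0 + w₁ • fourierLp (T := 1) 2 1})ᗮ

end NeilToeplitz

end

/-!
If `T_φ^𝒱 g = 0`, then `φ g` is orthogonal to `g` and to `χ² H²`. These two conditions do not
involve `𝒱`; they leave only the Fourier coefficients `±1` of the real function `φ |g|²`, which
is the modulus identity. Conversely, if `g(0) ≠ 0` and `𝒱` is the complement of `g(0) + g'(0) z`
in `ℂ ⊕ ℂ z`, then `H²_𝒱 = ℂ g + χ² H²`, so the two conditions give `T_φ^𝒱 g = 0`.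

For outerness, let `θ` be the component of `g` orthogonal to `χ [g]`, where `[g]` is the closed
shift-invariant subspace generated by `g`. Beurling's argument shows that `|θ|` is constant and that
`h = conj θ * g` is in `H²`. Pairing `φ g` with `χⁿ h`, `n ≥ 2`, gives
`c θ̂(n - 1) + conj c θ̂(n + 1) = 0`. So `|θ̂|` has period two on `n ≥ 1`, and as it tends to zero,
`θ` is a nonzero constant lying in `[g]`.

If `g` and `h` both satisfy the two conditions, then `conj g * φ h` is a trigonometric polynomial
`P` of degree one with `|P|² = (φ |g|²) (φ |h|²)`. It vanishes at a zero `z` of `φ |g|²` and at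
`-z`, hence its constant term `⟪g, φ h⟫` is zero. So the functions satisfying the two conditions
form a linear space. Its nonzero elements are outer and do not vanish at the origin, so evaluation
at the origin is injective on it and its dimension is at most one.
-/

noncomputable section

namespace NeilToeplitz

open MeasureTheory Filter Topology
open scoped ENNReal ComplexConjugate InnerProductSpace BoundedContinuousFunction NNReal

theorem ae_eq_zero_of_forall_integral_smul_eq_zero {X E : Type*} [TopologicalSpace X]
    [HasOuterApproxClosed X] [MeasurableSpace X] [BorelSpace X] {μ : Measure X}
    [NormedAddCommGroup E] [NormedSpace ℝ E] [CompleteSpace E] {F : X → E} (hF : Integrable F μ)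
    (h : ∀ k : X →ᵇ ℝ≥0, ∫ x, (k x : ℝ) • F x ∂μ = 0) : F =ᵐ[μ] 0 := by
  refine ae_eq_zero_of_forall_setIntegral_isClosed_eq_zero hF fun s hs => ?_
  rw [← integral_indicator hs.measurableSet]
  have hlim : Tendsto (fun n => ∫ x, (hs.apprSeq n x : ℝ) • F x ∂μ) atTop
      (𝓝 (∫ x, s.indicator F x ∂μ)) := by
    refine tendsto_integral_of_dominated_convergence (fun x => ‖F x‖) (fun n => ?_) hF.norm
      (fun n => .of_forall fun x => ?_) (.of_forall fun x => ?_)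
    · exact (NNReal.continuous_coe.comp (hs.apprSeq n).continuous).aestronglyMeasurable.smul hF.1
    · rw [norm_smul, NNReal.norm_eq]
      exact mul_le_of_le_one_left (norm_nonneg _)
        (HasOuterApproxClosed.apprSeq_apply_le_one hs n x)
    · have hx := tendsto_pi_nhds.1 (HasOuterApproxClosed.tendsto_apprSeq hs) x
      have hsmul := ((NNReal.continuous_coe.tendsto _).comp hx).smul_const (F x)
      by_cases hxs : x ∈ s <;> simpa [hxs] using hsmul
  simp only [h] at hlim
  exact tendsto_nhds_unique hlim tendsto_const_nhds

section AddCircle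

variable {T : ℝ} [Fact (0 < T)]

theorem integral_mul_eq_zero_of_fourierCoeff_eq_zero {F : AddCircle T → ℂ}
    (hF : Integrable F AddCircle.haarAddCircle) (h : ∀ n, fourierCoeff F n = 0)
    (k : C(AddCircle T, ℂ)) : ∫ x, k x * F x ∂AddCircle.haarAddCircle = 0 := by
  let L : C(AddCircle T, ℂ) →L[ℂ] ℂ := L1.integralCLM' ℂ ∘L
    ((ContinuousLinearMap.mul ℂ ℂ).holderL AddCircle.haarAddCircle ∞ 1 1).flip (hF.toL1 F) ∘L
      ContinuousMap.toLp ∞ AddCircle.haarAddCircle ℂ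
  have hL (k : C(AddCircle T, ℂ)) : L k = ∫ x, k x * F x ∂AddCircle.haarAddCircle := by
    change L1.integralCLM' ℂ ((ContinuousLinearMap.mul ℂ ℂ).holder 1
      (ContinuousMap.toLp ∞ AddCircle.haarAddCircle ℂ k) (hF.toL1 F)) = _
    rw [← L1.integral_eq' ℂ, L1.integral_eq_integral]
    refine integral_congr_ae ?_
    filter_upwards [ContinuousLinearMap.coeFn_holder (r := 1) (ContinuousLinearMap.mul ℂ ℂ)
      (ContinuousMap.toLp ∞ AddCircle.haarAddCircle ℂ k) (hF.toL1 F),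
      ContinuousMap.coeFn_toLp (p := ∞) AddCircle.haarAddCircle (𝕜 := ℂ) k, hF.coeFn_toL1]
      with x hx hk hFx
    exact hx.trans (by rw [hk, hFx, ContinuousLinearMap.mul_apply'])
  have hL0 : L = 0 := by
    refine ContinuousLinearMap.ext_on (s := Set.range (@fourier T)) ?_ ?_
    · exact (Submodule.dense_iff_topologicalClosure_eq_top).2 span_fourier_closure_eq_top
    · rintro _ ⟨n, rfl⟩
      rw [hL, zero_apply, ← h (-n), fourierCoeff, neg_neg]
      rfl
  rw [← hL, hL0, zero_apply]

theorem ae_eq_of_fourierCoeff_eq {F G : AddCircle T → ℂ}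
    (hF : Integrable F AddCircle.haarAddCircle) (hG : Integrable G AddCircle.haarAddCircle)
    (h : ∀ n, fourierCoeff F n = fourierCoeff G n) : F =ᵐ[AddCircle.haarAddCircle] G := by
  have hsub (n : ℤ) : fourierCoeff (F - G) n = 0 := by
    simp only [fourierCoeff, Pi.sub_apply, smul_sub,
      integral_sub (hF.fourier_smul (-n)) (hG.fourier_smul (-n))]
    exact sub_eq_zero.2 (h n)
  refine (sub_ae_eq_zero _ _).1 (ae_eq_zero_of_forall_integral_smul_eq_zero (hF.sub hG) fun k => ?_)
  simp only [Complex.real_smul]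
  exact integral_mul_eq_zero_of_fourierCoeff_eq_zero (hF.sub hG) hsub
    ⟨fun x => ((k x : ℝ) : ℂ), by fun_prop⟩

theorem ae_eq_sum_of_fourierCoeff_eq_zero {F : AddCircle T → ℂ}
    (hF : Integrable F AddCircle.haarAddCircle) (s : Finset ℤ)
    (h : ∀ n ∉ s, fourierCoeff F n = 0) :
    ∀ᵐ x ∂AddCircle.haarAddCircle, F x = ∑ n ∈ s, fourierCoeff F n * fourier n x := by
  have hterm (n : ℤ) : Integrable (fun x => fourierCoeff F n * fourier n x)
      (AddCircle.haarAddCircle (T := T)) :=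
    ((fourier n).continuous.integrable_of_hasCompactSupport
      (HasCompactSupport.of_compactSpace _)).const_mul _
  have hcoeff (n : ℤ) : fourierCoeff F n =
      fourierCoeff (∑ m ∈ s, fun x : AddCircle T => fourierCoeff F m * fourier m x) n := by
    rw [fourierCoeff.sum s _ fun m _ => hterm m, Finset.sum_apply]
    simp only [fourierCoeff.const_mul, fourierCoeff_fourier, Pi.single_apply, mul_ite, mul_one,
      mul_zero, Finset.sum_ite_eq]
    split_ifs with hn
    exacts [rfl, h n hn]
  filter_upwards [ae_eq_of_fourierCoeff_eq hF (integrable_finsetSum' s fun n _ => hterm n) hcoeff]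
    with x hx
  rw [hx, Finset.sum_apply]

theorem fourierCoeff_conj (F : AddCircle T → ℂ) (n : ℤ) :
    fourierCoeff (fun x => conj (F x)) n = conj (fourierCoeff F (-n)) := by
  rw [fourierCoeff, fourierCoeff, ← integral_conj]
  simp only [smul_eq_mul, map_mul, neg_neg, ← fourier_neg]

theorem fourierCoeff_fourier_mul (F : AddCircle T → ℂ) (k n : ℤ) :
    fourierCoeff (fun x => fourier k x * F x) n = fourierCoeff F (n - k) := by
  simp only [fourierCoeff, smul_eq_mul, ← mul_assoc, ← fourier_add,
    show -n + k = -(n - k) by ring]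

end AddCircle

theorem eq_zero_of_norm_add_eq_of_tendsto_zero {E : Type*} [NormedAddCommGroup E] {u : ℕ → E}
    {p : ℕ} (hp : 0 < p) (hu : ∀ n, ‖u (n + p)‖ = ‖u n‖) (hlim : Tendsto u atTop (𝓝 0)) :
    u = 0 := by
  have hiter (n k : ℕ) : ‖u (n + k * p)‖ = ‖u n‖ := by
    induction k with
    | zero => simp
    | succ k ih => rw [add_one_mul, ← add_assoc, hu, ih]
  funext n
  have hsub : Tendsto (fun k : ℕ => n + k * p) atTop atTop :=
    tendsto_atTop_mono (fun k => (Nat.le_mul_of_pos_right k hp).trans (Nat.le_add_left _ n))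
      tendsto_id
  have h := (hlim.comp hsub).norm
  simp only [Function.comp_def, hiter, norm_zero] at h
  exact norm_eq_zero.1 (tendsto_nhds_unique tendsto_const_nhds h)

theorem inner_eq_integral (f g : L2) : ⟪f, g⟫_ℂ = ∫ x, conj (f x) * g x ∂arc := by
  simp only [L2.inner_def, RCLike.inner_apply, mul_comm]

theorem integrable_conj_mul (f g : L2) : Integrable (fun x => conj (f x) * g x) arc := by
  simpa only [RCLike.inner_apply, mul_comm] using L2.integrable_inner (𝕜 := ℂ) f g

theorem integrable_coeFn (f : L2) : Integrable f arc :=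
  (Lp.memLp f).integrable one_le_two

theorem ext_fourierCoeff {f g : L2} (h : ∀ n, fourierCoeff f n = fourierCoeff g n) : f = g :=
  Lp.ext (ae_eq_of_fourierCoeff_eq (integrable_coeFn f) (integrable_coeFn g) h)

theorem fourierCoeff_fourierLp (m n : ℤ) :
    fourierCoeff (fourierLp (T := 1) 2 m) n = if n = m then 1 else 0 := by
  rw [fourierCoeff_congr_ae (coeFn_fourierLp 2 m), fourierCoeff_fourier, Pi.single_apply]

theorem tendsto_fourierCoeff_atTop (f : L2) :
    Tendsto (fun n : ℕ => fourierCoeff f n) atTop (𝓝 0) := by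
  have hsq : Tendsto (fun n : ℤ => ‖fourierCoeff f n‖) cofinite (𝓝 0) := by
    simpa using (hasSum_sq_fourierCoeff f).summable.tendsto_cofinite_zero.sqrt
  exact (tendsto_zero_iff_norm_tendsto_zero.2 hsq).comp
    (Nat.cofinite_eq_atTop ▸ (Nat.cast_injective (R := ℤ)).tendsto_cofinite)

/-- The `n`-th Fourier coefficient as a continuous linear functional on `L²(𝕋)`. -/
def coeffCLM (n : ℤ) : L2 →L[ℂ] ℂ := innerSL ℂ (fourierLp (T := 1) 2 n)

theorem coeffCLM_apply (n : ℤ) (f : L2) : coeffCLM n f = fourierCoeff f n :=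
  (fourierCoeff_eq_inner f n).symm

theorem mem_ker_coeffCLM {n : ℤ} {f : L2} : f ∈ (coeffCLM n).ker ↔ fourierCoeff f n = 0 := by
  rw [LinearMap.mem_ker, ContinuousLinearMap.coe_coe, coeffCLM_apply]

/-- Multiplication by `χⁿ` on `L²(𝕋)`. -/
def shift (n : ℤ) : L2 →L[ℂ] L2 :=
  (ContinuousLinearMap.mul ℂ ℂ).holderL arc ∞ 2 2 (fourierLp (T := 1) ∞ n)

theorem coeFn_shift (n : ℤ) (f : L2) : shift n f =ᵐ[arc] fun x => fourier n x * f x := by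
  filter_upwards [ContinuousLinearMap.coeFn_holder (r := 2) (ContinuousLinearMap.mul ℂ ℂ)
    (fourierLp (T := 1) ∞ n) f, coeFn_fourierLp (T := 1) ∞ n] with x hx hn
  exact hx.trans (by rw [hn, ContinuousLinearMap.mul_apply'])

theorem inner_shift_left (n : ℤ) (f g : L2) :
    ⟪shift n f, g⟫_ℂ = fourierCoeff (fun x => conj (f x) * g x) n := by
  rw [inner_eq_integral, fourierCoeff]
  refine integral_congr_ae ?_
  filter_upwards [coeFn_shift n f] with x hx
  rw [hx, fourier_neg, map_mul, smul_eq_mul, mul_assoc]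

theorem fourierCoeff_shift (k n : ℤ) (f : L2) :
    fourierCoeff (shift k f) n = fourierCoeff f (n - k) := by
  rw [fourierCoeff_congr_ae (coeFn_shift k f), fourierCoeff_fourier_mul]

theorem shift_shift (m n : ℤ) (f : L2) : shift m (shift n f) = shift (m + n) f :=
  ext_fourierCoeff fun k => by
    simp only [fourierCoeff_shift, sub_sub]

theorem shift_zero (f : L2) : shift 0 f = f :=
  ext_fourierCoeff fun k => by rw [fourierCoeff_shift, sub_zero]

theorem shift_fourierLp (m n : ℤ) :
    shift m (fourierLp (T := 1) 2 n) = fourierLp (T := 1) 2 (m + n) :=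
  ext_fourierCoeff fun k => by
    simp only [fourierCoeff_shift, fourierCoeff_fourierLp, sub_eq_iff_eq_add']

theorem inner_shift_right (n : ℤ) (f g : L2) : ⟪f, shift n g⟫_ℂ = ⟪shift (-n) f, g⟫_ℂ := by
  rw [inner_eq_integral, inner_shift_left, fourierCoeff]
  refine integral_congr_ae ?_
  filter_upwards [coeFn_shift n g] with x hx
  rw [hx, neg_neg, smul_eq_mul, mul_left_comm]

theorem shift_mem_H2 {f : L2} (hf : f ∈ H2) {n : ℤ} (hn : 0 ≤ n) : shift n f ∈ H2 := fun m hm => by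
  rw [fourierCoeff_shift]
  exact hf _ (by lia)

theorem fourierLp_mem_H2 {n : ℤ} (hn : 0 ≤ n) : fourierLp (T := 1) 2 n ∈ H2 := fun m hm => by
  rw [fourierCoeff_fourierLp, if_neg (by lia)]

theorem H2_le_of_fourierLp_mem {M : Submodule ℂ L2} (hM : IsClosed (M : Set L2))
    (h : ∀ n : ℕ, fourierLp (T := 1) 2 n ∈ M) : H2 ≤ M := by
  intro f hf
  refine hM.mem_of_tendsto (hasSum_fourier_series_L2 f) (.of_forall fun s => ?_)
  refine M.sum_mem fun n _ => ?_
  rcases lt_or_ge n 0 with hn | hn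
  · rw [hf n hn, zero_smul]
    exact M.zero_mem
  · lift n to ℕ using hn
    exact M.smul_mem _ (h n)

theorem fourierCoeff_mul_eq_zero {f g : L2} (hf : f ∈ H2) {n : ℤ}
    (hg : ∀ m ≤ n, fourierCoeff g m = 0) : fourierCoeff (fun x => f x * g x) n = 0 := by
  have hinner (f : L2) : ⟪shift n (star g), f⟫_ℂ = fourierCoeff (fun x => f x * g x) n := by
    rw [inner_shift_left]
    refine congrFun (fourierCoeff_congr_ae ?_) n
    filter_upwards [Lp.coeFn_star g] with x hx
    rw [hx, Pi.star_apply, RCLike.star_def, Complex.conj_conj, mul_comm]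
  have hker : H2 ≤ (innerSL ℂ (shift n (star g))).ker := by
    refine H2_le_of_fourierLp_mem (ContinuousLinearMap.isClosed_ker _) fun k => ?_
    rw [LinearMap.mem_ker, ContinuousLinearMap.coe_coe, innerSL_apply_apply, hinner,
      ← hg (n - k) (by lia), ← fourierCoeff_fourier_mul g k n]
    refine congrFun (fourierCoeff_congr_ae ?_) n
    filter_upwards [coeFn_fourierLp (T := 1) 2 k] with x hx
    rw [hx]
  exact (hinner f).symm.trans (hker hf)

/-! ### Shift-invariant subspaces -/

/-- The closed shift-invariant subspace generated by `g`. -/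
def cyclicSubspace (g : L2) : Submodule ℂ L2 :=
  (Submodule.span ℂ (Set.range fun n : ℕ => shift n g)).topologicalClosure

theorem isClosed_cyclicSubspace (g : L2) : IsClosed (cyclicSubspace g : Set L2) :=
  Submodule.isClosed_topologicalClosure _

instance completeSpace_cyclicSubspace (g : L2) : CompleteSpace (cyclicSubspace g) :=
  (isClosed_cyclicSubspace g).completeSpace_coe

theorem shift_mem_cyclicSubspace (g : L2) (n : ℕ) : shift n g ∈ cyclicSubspace g :=
  Submodule.le_topologicalClosure _ (Submodule.subset_span ⟨n, rfl⟩)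

theorem self_mem_cyclicSubspace (g : L2) : g ∈ cyclicSubspace g := by
  simpa [shift_zero] using shift_mem_cyclicSubspace g 0

theorem cyclicSubspace_le {g : L2} {M : Submodule ℂ L2} (hM : IsClosed (M : Set L2))
    (h : ∀ n : ℕ, shift n g ∈ M) : cyclicSubspace g ≤ M :=
  Submodule.topologicalClosure_minimal _ (Submodule.span_le.2 (Set.range_subset_iff.2 h)) hM

theorem shift_mem_cyclicSubspace_shift {f g : L2} (hf : f ∈ cyclicSubspace g) (k : ℤ) :
    shift k f ∈ cyclicSubspace (shift k g) := by
  have hle : cyclicSubspace g ≤ (cyclicSubspace (shift k g)).comap (shift k).toLinearMap := by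
    refine cyclicSubspace_le ((isClosed_cyclicSubspace _).preimage (shift k).continuous) fun n => ?_
    rw [Submodule.mem_comap, ContinuousLinearMap.coe_coe, shift_shift, add_comm, ← shift_shift]
    exact shift_mem_cyclicSubspace _ n
  exact hle hf

theorem cyclicSubspace_shift_le (g : L2) (n : ℕ) : cyclicSubspace (shift n g) ≤ cyclicSubspace g :=
  cyclicSubspace_le (isClosed_cyclicSubspace g) fun m => by
    rw [shift_shift]
    exact_mod_cast shift_mem_cyclicSubspace g (m + n)

theorem fourierCoeff_eq_zero_of_mem_cyclicSubspace {f g : L2} {N : ℤ}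
    (hg : ∀ n < N, fourierCoeff g n = 0) (hf : f ∈ cyclicSubspace g) {n : ℤ} (hn : n < N) :
    fourierCoeff f n = 0 := by
  have hle : cyclicSubspace g ≤ (coeffCLM n).ker := by
    refine cyclicSubspace_le (ContinuousLinearMap.isClosed_ker _) fun k => ?_
    rw [mem_ker_coeffCLM, fourierCoeff_shift]
    exact hg _ (by lia)
  exact mem_ker_coeffCLM.1 (hle hf)

theorem notMem_cyclicSubspace_shift_one {g : L2} (hg : g ∈ H2) (hg0 : g ≠ 0) :
    g ∉ cyclicSubspace (shift 1 g) := by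
  intro hmem
  have hvanish (N : ℕ) : ∀ n < (N : ℤ), fourierCoeff g n = 0 := by
    induction N with
    | zero => exact_mod_cast hg
    | succ N ih =>
      refine fun n hn => fourierCoeff_eq_zero_of_mem_cyclicSubspace (fun m hm => ?_) hmem hn
      rw [fourierCoeff_shift]
      exact ih _ (by lia)
  refine hg0 (ext_fourierCoeff fun n => ?_)
  rw [hvanish (n.toNat + 1) n (by lia), ← coeffCLM_apply, map_zero]

/-- The component of `g` orthogonal to `χ [g]`, where `[g]` is the closed shift-invariant subspace
generated by `g`. By Beurling's argument it is a multiple of the inner factor of `g`. -/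
def wanderingVector (g : L2) : L2 := g - (cyclicSubspace (shift 1 g)).starProjection g

theorem wanderingVector_mem (g : L2) : wanderingVector g ∈ cyclicSubspace g :=
  Submodule.sub_mem _ (self_mem_cyclicSubspace g)
    (cyclicSubspace_shift_le g 1 (Submodule.starProjection_apply_mem _ _))

theorem wanderingVector_ne_zero {g : L2} (hg : g ∈ H2) (hg0 : g ≠ 0) : wanderingVector g ≠ 0 := by
  intro h
  refine notMem_cyclicSubspace_shift_one hg hg0 ?_
  have hproj := Submodule.starProjection_apply_mem (cyclicSubspace (shift 1 g)) g
  rwa [← sub_eq_zero.1 h] at hproj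

theorem inner_wanderingVector_shift {f g : L2} (hf : f ∈ cyclicSubspace g) {n : ℤ} (hn : 1 ≤ n) :
    ⟪wanderingVector g, shift n f⟫_ℂ = 0 := by
  lift n to ℕ using by lia
  obtain ⟨k, rfl⟩ : ∃ k, n = k + 1 := ⟨n - 1, by lia⟩
  refine (Submodule.mem_orthogonal' _ _).1
    (Submodule.sub_starProjection_mem_orthogonal (K := cyclicSubspace (shift 1 g)) g) _ ?_
  refine cyclicSubspace_shift_le _ k ?_
  rw [shift_shift]
  exact_mod_cast shift_mem_cyclicSubspace_shift hf (k + 1)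

-- `|θ|²` is real and orthogonal to all `χⁿ` with `n ≥ 1`, so only its mean survives.
theorem norm_wanderingVector_ae_eq (g : L2) :
    ∀ᵐ x ∂arc, ‖wanderingVector g x‖ = ‖wanderingVector g‖ := by
  set θ := wanderingVector g
  have hpos (n : ℤ) (hn : 1 ≤ n) : ⟪shift n θ, θ⟫_ℂ = 0 :=
    inner_eq_zero_symm.1 (inner_wanderingVector_shift (wanderingVector_mem g) hn)
  have hcoeff : ∀ n ∉ ({0} : Finset ℤ), fourierCoeff (fun x => conj (θ x) * θ x) n = 0 := by
    intro n hn
    rw [← inner_shift_left]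
    rcases lt_or_gt_of_ne (Finset.notMem_singleton.1 hn) with hn | hn
    · rw [← neg_neg n, ← inner_shift_right, inner_eq_zero_symm]
      exact hpos _ (by lia)
    · exact hpos n hn
  filter_upwards [ae_eq_sum_of_fourierCoeff_eq_zero (integrable_conj_mul θ θ) {0} hcoeff] with x hx
  rw [Finset.sum_singleton, ← inner_shift_left, shift_zero, fourier_zero, mul_one,
    inner_self_eq_norm_sq_to_K, Complex.conj_mul', RCLike.ofReal_eq_complex_ofReal] at hx
  exact (sq_eq_sq₀ (norm_nonneg _) (norm_nonneg _)).1 (by exact_mod_cast hx)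

theorem ae_ne_zero_of_mem_H2 {g : L2} (hg : g ∈ H2) (hg0 : g ≠ 0) : ∀ᵐ x ∂arc, g x ≠ 0 := by
  let s : Set UnitAddCircle := {x | g x = 0}
  have hs : MeasurableSet s := (Lp.stronglyMeasurable g).measurable (measurableSet_singleton 0)
  have hle : cyclicSubspace g ≤ (LpToLpRestrictCLM UnitAddCircle ℂ ℂ arc 2 s).ker := by
    refine cyclicSubspace_le (ContinuousLinearMap.isClosed_ker _) fun n => ?_
    refine LinearMap.mem_ker.2 (Lp.ext ?_)
    filter_upwards [LpToLpRestrictCLM_coeFn ℂ s (shift n g), ae_restrict_mem hs,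
      ae_restrict_of_ae (coeFn_shift n g), Lp.coeFn_zero ℂ 2 (arc.restrict s)]
      with x hx hxs hshift hzero
    exact hx.trans (by rw [hshift, hxs, mul_zero, hzero, Pi.zero_apply])
  have hres : LpToLpRestrictCLM UnitAddCircle ℂ ℂ arc 2 s (wanderingVector g) = 0 :=
    hle (wanderingVector_mem g)
  have hθs : ∀ᵐ x ∂arc.restrict s, wanderingVector g x = 0 := by
    filter_upwards [LpToLpRestrictCLM_coeFn ℂ s (wanderingVector g),
      hres ▸ Lp.coeFn_zero ℂ 2 (arc.restrict s)] with x hx hzero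
    exact hx.symm.trans hzero
  filter_upwards [(ae_restrict_iff' hs).1 hθs, norm_wanderingVector_ae_eq g] with x hx hnorm hgx
  rw [hx hgx, norm_zero, eq_comm, norm_eq_zero] at hnorm
  exact wanderingVector_ne_zero hg hg0 hnorm

/-! ### The disc algebra and outer functions -/

theorem chi_eq_fourier (x : UnitAddCircle) : chi x = fourier 1 x := fourier_one.symm

theorem chi_pow (x : UnitAddCircle) (n : ℕ) : chi x ^ n = fourier (n : ℤ) x := by
  induction n with
  | zero => rw [pow_zero, Nat.cast_zero, fourier_zero]
  | succ n ih => rw [pow_succ, ih, chi_eq_fourier, Nat.cast_succ, fourier_add]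

theorem norm_chi (x : UnitAddCircle) : ‖chi x‖ = 1 := Circle.norm_coe _

theorem continuous_chi : Continuous chi :=
  continuous_subtype_val.comp AddCircle.continuous_toCircle

theorem exists_chi_eq {z : ℂ} (hz : ‖z‖ = 1) : ∃ x, chi x = z := by
  obtain ⟨x, hx⟩ := (AddCircle.homeomorphCircle (T := 1) one_ne_zero).surjective
    ⟨z, mem_sphere_zero_iff_norm.2 hz⟩
  exact ⟨x, by rw [chi, ← AddCircle.homeomorphCircle_apply one_ne_zero, hx]⟩

theorem exists_mul_chi_add_conj_eq_zero (c : ℂ) : ∃ x, c * chi x + conj (c * chi x) = 0 := by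
  obtain rfl | hc := eq_or_ne c 0
  · exact ⟨0, by simp⟩
  obtain ⟨x, hx⟩ := exists_chi_eq (z := Complex.I * conj c / ‖c‖) (by simp [hc])
  refine ⟨x, ?_⟩
  rw [hx]
  simp only [map_mul, map_div₀, Complex.conj_conj, Complex.conj_I, Complex.conj_ofReal]
  ring

theorem chi_coe (t : ℝ) : chi t = circleMap 0 1 (2 * Real.pi * t) := by
  rw [chi, AddCircle.toCircle_apply_mk, Circle.coe_exp, circleMap_zero, div_one,
    Complex.ofReal_one, one_mul]

theorem integral_comp_chi {E : Type*} [NormedAddCommGroup E] [NormedSpace ℂ E] (f : ℂ → E) :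
    ∫ x, f (chi x) ∂arc = Real.circleAverage f 0 1 := by
  have hcoeff := fourierCoeff_eq_intervalIntegral (fun x => f (chi x)) 0 0
  simp only [fourierCoeff, neg_zero, fourier_zero, one_smul, one_div, inv_one, zero_add,
    chi_coe] at hcoeff
  rw [hcoeff,
    intervalIntegral.integral_comp_mul_left (fun t => f (circleMap 0 1 t)) (by positivity),
    mul_zero, mul_one, Real.circleAverage_def]

theorem exists_mem_H2_ae_eq_comp_chi {a : ℂ → ℂ} (ha : DiffContOnCl ℂ a (Metric.ball 0 1)) :
    ∃ A ∈ H2, ∀ᵐ x ∂arc, A x = a (chi x) := by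
  have hcont : Continuous fun x => a (chi x) :=
    ha.continuousOn_ball.comp_continuous continuous_chi fun x => by simp [norm_chi]
  refine ⟨ContinuousMap.toLp 2 arc ℂ ⟨_, hcont⟩, fun n hn => ?_, ContinuousMap.coeFn_toLp arc _⟩
  obtain ⟨k, hk0, rfl⟩ : ∃ k : ℕ, k ≠ 0 ∧ n = -k := ⟨n.natAbs, by lia, by lia⟩
  have hdiff : DiffContOnCl ℂ (fun z => z ^ k * a z) (Metric.ball 0 |1|) := by
    rw [abs_one]
    exact (differentiable_pow k).diffContOnCl.smul ha
  rw [fourierCoeff_toLp, fourierCoeff, neg_neg]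
  calc ∫ x, fourier (k : ℤ) x • a (chi x) ∂arc = ∫ x, chi x ^ k * a (chi x) ∂arc := by
        simp only [chi_pow, smul_eq_mul]
    _ = Real.circleAverage (fun z => z ^ k * a z) 0 1 :=
        integral_comp_chi fun z => z ^ k * a z
    _ = 0 := by rw [hdiff.circleAverage, zero_pow hk0, zero_mul]

theorem IsDiscAlgebraMultiple.fourierCoeff_eq_zero {f g : L2} (hf : IsDiscAlgebraMultiple g f)
    {n : ℤ} (hg : ∀ m ≤ n, fourierCoeff g m = 0) : fourierCoeff f n = 0 := by
  obtain ⟨a, ha, hfa⟩ := hf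
  obtain ⟨A, hA, hAa⟩ := exists_mem_H2_ae_eq_comp_chi ha
  rw [← fourierCoeff_mul_eq_zero hA hg]
  refine congrFun (fourierCoeff_congr_ae ?_) n
  filter_upwards [hfa, hAa] with x hfx hAx
  rw [hfx, hAx]

/-- The multiples `a g` of `g` by functions `a` of the disc algebra, as a subspace. -/
def discAlgebraMultiples (g : L2) : Submodule ℂ L2 where
  carrier := {f | IsDiscAlgebraMultiple g f}
  zero_mem' := ⟨fun _ => 0, diffContOnCl_const, by
    filter_upwards [Lp.coeFn_zero ℂ 2 arc] with x hx
    rw [hx, zero_mul, Pi.zero_apply]⟩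
  add_mem' := by
    rintro f₁ f₂ ⟨a, ha, haf⟩ ⟨b, hb, hbf⟩
    refine ⟨a + b, ha.add hb, ?_⟩
    filter_upwards [haf, hbf, Lp.coeFn_add f₁ f₂] with x hax hbx hx
    rw [hx, Pi.add_apply, Pi.add_apply, hax, hbx, add_mul]
  smul_mem' := by
    rintro c f ⟨a, ha, haf⟩
    refine ⟨c • a, ha.const_smul c, ?_⟩
    filter_upwards [haf, Lp.coeFn_smul c f] with x hax hx
    rw [hx, Pi.smul_apply, Pi.smul_apply, hax, smul_mul_assoc]

theorem isOuter_of_H2_le_cyclicSubspace {g : L2} (hg : g ∈ H2) (h : H2 ≤ cyclicSubspace g) :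
    IsOuter g := by
  have hle : cyclicSubspace g ≤ (discAlgebraMultiples g).topologicalClosure := by
    refine cyclicSubspace_le (Submodule.isClosed_topologicalClosure _) fun n =>
      Submodule.le_topologicalClosure _ ⟨fun z => z ^ n, (differentiable_pow n).diffContOnCl, ?_⟩
    filter_upwards [coeFn_shift n g] with x hx
    rw [hx, chi_pow]
  refine ⟨hg, Set.Subset.antisymm (closure_minimal (fun f hf n hn => ?_) isClosed_H2) (h.trans hle)⟩
  exact hf.fourierCoeff_eq_zero fun m hm => hg m (by lia)

namespace IsOuter

variable {g : L2} (hg : IsOuter g)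
include hg

theorem H2_le {M : Submodule ℂ L2} (hM : IsClosed (M : Set L2))
    (h : ∀ f, IsDiscAlgebraMultiple g f → f ∈ M) : H2 ≤ M :=
  hg.2.symm.subset.trans (closure_minimal h hM)

theorem fourierCoeff_zero_ne_zero : fourierCoeff g 0 ≠ 0 := by
  intro h0
  have hle : H2 ≤ (coeffCLM 0).ker := by
    refine hg.H2_le (ContinuousLinearMap.isClosed_ker _) fun f hf => ?_
    refine mem_ker_coeffCLM.2 (hf.fourierCoeff_eq_zero fun n hn => ?_)
    rcases hn.lt_or_eq with hn | rfl
    exacts [hg.1 n hn, h0]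
  have hone := mem_ker_coeffCLM.1 (hle (fourierLp_mem_H2 le_rfl))
  rw [fourierCoeff_fourierLp, if_pos rfl] at hone
  exact one_ne_zero hone

theorem ne_zero : g ≠ 0 := by
  rintro rfl
  refine hg.fourierCoeff_zero_ne_zero ?_
  rw [← coeffCLM_apply, map_zero]

end IsOuter

theorem toDisc_zero (g : L2) : toDisc g 0 = fourierCoeff g 0 := by
  rw [toDisc, tsum_eq_single 0 fun n hn => by rw [zero_pow hn, mul_zero]]
  simp

theorem norm_fourierCoeff_le (g : L2) (n : ℤ) : ‖fourierCoeff g n‖ ≤ ‖g‖ := by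
  rw [fourierCoeff_eq_inner]
  exact (norm_inner_le_norm _ _).trans_eq (by rw [orthonormal_fourier.1 n, one_mul])

theorem deriv_toDisc_zero (g : L2) : deriv (toDisc g) 0 = fourierCoeff g 1 := by
  let p := FormalMultilinearSeries.ofScalars ℂ fun n : ℕ => fourierCoeff g n
  have hrad : 0 < p.radius := by
    refine zero_lt_one.trans_le (p.le_radius_of_bound (r := 1) ‖g‖ fun n => ?_)
    rw [FormalMultilinearSeries.ofScalars_norm, NNReal.coe_one, one_pow, mul_one]
    exact norm_fourierCoeff_le g n
  have hsum : p.sum = toDisc g := FormalMultilinearSeries.ofScalarsSum_eq_tsum _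
  have hderiv := (p.hasFPowerSeriesOnBall hrad).hasFPowerSeriesAt.deriv
  rw [hsum] at hderiv
  rw [hderiv, FormalMultilinearSeries.ofScalars_apply_eq]
  simp

theorem conj_mul_chi (c : ℂ) (x : UnitAddCircle) :
    conj (c * chi x) = conj c * fourier (-1) x := by
  rw [map_mul, chi_eq_fourier, fourier_neg]

theorem fourierCoeff_band_mul (c : ℂ) {F : UnitAddCircle → ℂ} (hF : Integrable F arc) (n : ℤ) :
    fourierCoeff (fun x => (c * chi x + conj (c * chi x)) * F x) n =
      c * fourierCoeff F (n - 1) + conj c * fourierCoeff F (n + 1) := by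
  have hadd := congrFun (fourierCoeff.add (T := 1)
    ((hF.fourier_smul 1).const_mul c) ((hF.fourier_smul (-1)).const_mul (conj c))) n
  simp only [Pi.add_apply, smul_eq_mul, fourierCoeff.const_mul, fourierCoeff_fourier_mul,
    sub_neg_eq_add] at hadd
  rw [← hadd]
  congr 1
  ext x
  rw [conj_mul_chi, chi_eq_fourier, Pi.add_apply, add_mul, mul_assoc, mul_assoc]

/-! ### Kernel functions of Toeplitz operators -/

section Symbol

variable {φ : RealLinf} {g h : L2}

theorem coeFn_symbol_smul (φ : RealLinf) (f : L2) :
    (φ • f : L2) =ᵐ[arc] fun x => (φ x : ℂ) * f x := by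
  filter_upwards [Lp.coeFn_lpSMul (r := 2) φ f] with x hx
  rw [hx, Pi.smul_apply', Complex.real_smul]

theorem conj_mul_symbol_smul (φ : RealLinf) (g : L2) :
    (fun x => conj (g x) * (φ • g : L2) x) =ᵐ[arc] fun x => ((φ x * ‖g x‖ ^ 2 : ℝ) : ℂ) := by
  filter_upwards [coeFn_symbol_smul φ g] with x hx
  rw [hx, mul_left_comm, Complex.conj_mul', Complex.ofReal_mul, Complex.ofReal_pow]

theorem conj_inner_shift_symbol_smul (φ : RealLinf) (g h : L2) (n : ℤ) :
    conj ⟪shift (-n) h, (φ • g : L2)⟫_ℂ = ⟪shift n g, (φ • h : L2)⟫_ℂ := by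
  rw [inner_shift_left, inner_shift_left, ← fourierCoeff_conj]
  refine congrFun (fourierCoeff_congr_ae ?_) n
  filter_upwards [coeFn_symbol_smul φ g, coeFn_symbol_smul φ h] with x hg hh
  rw [hg, hh, map_mul, map_mul, Complex.conj_conj, Complex.conj_ofReal]
  ring

theorem ModulusIdentity.ne_zero {c : ℂ} (hid : ModulusIdentity φ g c) (hφ : φ ≠ 0) (hg : g ∈ H2)
    (hg0 : g ≠ 0) : c ≠ 0 := by
  rintro rfl
  refine hφ (Lp.ext ?_)
  filter_upwards [hid, ae_ne_zero_of_mem_H2 hg hg0, Lp.coeFn_zero ℝ ∞ arc] with x hx hgx h0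
  rw [h0, Pi.zero_apply]
  simpa [hgx] using hx

theorem ModulusIdentity.fourierCoeff_mul {c : ℂ} (hid : ModulusIdentity φ g c) (f : L2)
    (n : ℤ) : fourierCoeff (fun x => conj (g x) * (φ • g : L2) x * f x) n =
      c * fourierCoeff f (n - 1) + conj c * fourierCoeff f (n + 1) := by
  rw [← fourierCoeff_band_mul c (integrable_coeFn f)]
  refine congrFun (fourierCoeff_congr_ae ?_) n
  filter_upwards [hid, conj_mul_symbol_smul φ g] with x hx hgx
  rw [hgx, hx]

end Symbol

theorem mem_affinePolys {v : L2} : v ∈ affinePolys ↔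
    ∃ a b : ℂ, a • fourierLp (T := 1) 2 0 + b • fourierLp (T := 1) 2 1 = v :=
  Submodule.mem_span_pair

theorem inner_affine (a b : ℂ) (f : L2) :
    ⟪a • fourierLp (T := 1) 2 0 + b • fourierLp (T := 1) 2 1, f⟫_ℂ =
      conj a * fourierCoeff f 0 + conj b * fourierCoeff f 1 := by
  rw [inner_add_left, inner_smul_left, inner_smul_left, ← fourierCoeff_eq_inner,
    ← fourierCoeff_eq_inner]

theorem mem_H2V {V : Submodule ℂ L2} {f : L2} : f ∈ H2V V ↔ f ∈ H2 ∧ ∀ v ∈ V, ⟪v, f⟫_ℂ = 0 := by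
  rw [H2V, Submodule.mem_inf, Submodule.mem_orthogonal]

theorem shift_mem_H2V {V : Submodule ℂ L2} (hV : V ≤ affinePolys) {f : L2} (hf : f ∈ H2) {n : ℤ}
    (hn : 2 ≤ n) : shift n f ∈ H2V V := by
  refine mem_H2V.2 ⟨shift_mem_H2 hf (by lia), fun v hv => ?_⟩
  obtain ⟨a, b, rfl⟩ := mem_affinePolys.1 (hV hv)
  rw [inner_affine, fourierCoeff_shift, fourierCoeff_shift, hf _ (by lia), hf _ (by lia), mul_zero,
    mul_zero, add_zero]

/-- The kernel of the Toeplitz operator `T_φ^𝒱`, as a subspace of `L²(𝕋)`. -/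
def toeplitzKernel (φ : RealLinf) (V : Submodule ℂ L2) : Submodule ℂ L2 :=
  (LinearMap.ker (toeplitz φ V)).map (H2V V).subtype

section ToeplitzKernel

variable {φ : RealLinf} {V : Submodule ℂ L2} {g : L2}

theorem mem_toeplitzKernel :
    g ∈ toeplitzKernel φ V ↔ ∃ hg : g ∈ H2V V, toeplitz φ V ⟨g, hg⟩ = 0 := by
  simp [toeplitzKernel]

theorem mem_toeplitzKernel_iff_inner :
    g ∈ toeplitzKernel φ V ↔ g ∈ H2V V ∧ ∀ k ∈ H2V V, ⟪k, (φ • g : L2)⟫_ℂ = 0 := by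
  rw [mem_toeplitzKernel, ← exists_prop]
  refine exists_congr fun hg => ?_
  change (H2V V).orthogonalProjectionOnto (φ • g : L2) = 0 ↔ _
  rw [Submodule.orthogonalProjectionOnto_eq_zero_iff, Submodule.mem_orthogonal]

end ToeplitzKernel

/-- `g ∈ H²` with `φ g` orthogonal to `g` and to `χ² H²`. Any `g` in the kernel of `T_φ^𝒱` for some
`𝒱 ⊆ ℂ ⊕ ℂ z` has this property, in which `𝒱` does not occur. -/
structure IsKernelFunction (φ : RealLinf) (g : L2) : Prop where
  mem_H2 : g ∈ H2
  inner_self : ⟪g, (φ • g : L2)⟫_ℂ = 0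
  inner_shift_two : ∀ m ∈ H2, ⟪shift 2 m, (φ • g : L2)⟫_ℂ = 0

-- For `f` in the dense set of multiples `a g`, the pairing of `χ² f` with `φ g` is a Fourier
-- coefficient of the conjugate of `a φ |g|²`.
theorem IsOuter.isKernelFunction {φ : RealLinf} {g : L2} (hg : IsOuter g) {c : ℂ}
    (hid : ModulusIdentity φ g c) : IsKernelFunction φ g where
  mem_H2 := hg.1
  inner_self := by
    have hcoeff := hid.fourierCoeff_mul (fourierLp (T := 1) 2 0) 0
    simp only [fourierCoeff_fourierLp, zero_sub, zero_add, neg_eq_zero, one_ne_zero, if_false,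
      mul_zero, add_zero] at hcoeff
    rw [← shift_zero g, inner_shift_left, shift_zero, ← hcoeff]
    refine congrFun (fourierCoeff_congr_ae ?_) 0
    filter_upwards [coeFn_fourierLp (T := 1) 2 0] with x hx
    rw [hx, fourier_zero, mul_one]
  inner_shift_two m hm := by
    have hle : H2 ≤ (innerSL ℂ (shift (-2) (φ • g : L2))).ker := by
      refine hg.H2_le (ContinuousLinearMap.isClosed_ker _) fun f hf => ?_
      obtain ⟨a, ha, hfa⟩ := hf
      obtain ⟨A, hA, hAa⟩ := exists_mem_H2_ae_eq_comp_chi ha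
      have hcoeff := hid.fourierCoeff_mul A (-2)
      rw [hA _ (by lia), hA _ (by lia), mul_zero, mul_zero, add_zero] at hcoeff
      rw [LinearMap.mem_ker, ContinuousLinearMap.coe_coe, innerSL_apply_apply, inner_shift_left,
        ← hcoeff]
      refine congrFun (fourierCoeff_congr_ae ?_) (-2)
      filter_upwards [hfa, hAa, coeFn_symbol_smul φ g] with x hfx hAx hφx
      rw [hfx, hAx, hφx, map_mul, Complex.conj_ofReal]
      ring
    rw [inner_eq_zero_symm, inner_shift_right]
    exact hle hm

section CrossTerm

variable {φ : RealLinf} {g h : L2}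

theorem IsKernelFunction.inner_shift_symbol_smul_eq_zero (hg : g ∈ H2) (hh : IsKernelFunction φ h)
    {n : ℤ} (hn : 2 ≤ n) : ⟪shift n g, (φ • h : L2)⟫_ℂ = 0 := by
  rw [← add_sub_cancel 2 n, ← shift_shift]
  exact hh.inner_shift_two _ (shift_mem_H2 hg (by lia))

theorem IsKernelFunction.conj_mul_symbol_smul_ae_eq (hg : IsKernelFunction φ g)
    (hh : IsKernelFunction φ h) : ∀ᵐ x ∂arc, conj (g x) * (φ • h : L2) x =
      ⟪shift (-1) g, (φ • h : L2)⟫_ℂ * conj (chi x) + ⟪g, (φ • h : L2)⟫_ℂ +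
        ⟪shift 1 g, (φ • h : L2)⟫_ℂ * chi x := by
  have hcoeff : ∀ n ∉ ({-1, 0, 1} : Finset ℤ),
      fourierCoeff (fun x => conj (g x) * (φ • h : L2) x) n = 0 := by
    intro n hn
    simp only [Finset.mem_insert, Finset.mem_singleton] at hn
    rw [← inner_shift_left]
    rcases (by lia : 2 ≤ n ∨ 2 ≤ -n) with hn | hn
    · exact hh.inner_shift_symbol_smul_eq_zero hg.mem_H2 hn
    · rw [← conj_inner_shift_symbol_smul, hg.inner_shift_symbol_smul_eq_zero hh.mem_H2 hn, map_zero]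
  filter_upwards [ae_eq_sum_of_fourierCoeff_eq_zero (integrable_conj_mul g (φ • h : L2)) _ hcoeff]
    with x hx
  rw [hx, Finset.sum_insert (by decide), Finset.sum_pair (by decide)]
  simp only [← inner_shift_left, shift_zero, fourier_zero, mul_one, fourier_neg, ← chi_eq_fourier,
    add_assoc]

theorem IsKernelFunction.modulusIdentity (hg : IsKernelFunction φ g) :
    ModulusIdentity φ g ⟪shift 1 g, (φ • g : L2)⟫_ℂ := by
  filter_upwards [hg.conj_mul_symbol_smul_ae_eq hg, conj_mul_symbol_smul φ g] with x hx hgx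
  rw [← hgx, hx, hg.inner_self, map_mul, ← conj_inner_shift_symbol_smul φ g g 1, Complex.conj_conj]
  ring

-- With `P = conj g * φ h`, the identity `|P|² = (φ |g|²) (φ |h|²)` makes the trigonometric
-- polynomial `P` of degree one vanish at two antipodal zeros of `φ |g|²`, so its constant term is
-- zero.
theorem IsKernelFunction.inner_eq_zero (hg : IsKernelFunction φ g) (hh : IsKernelFunction φ h) :
    ⟪g, (φ • h : L2)⟫_ℂ = 0 := by
  set c := ⟪shift 1 g, (φ • g : L2)⟫_ℂ
  set d := ⟪shift 1 h, (φ • h : L2)⟫_ℂ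
  let P (x : UnitAddCircle) : ℂ :=
    ⟪shift (-1) g, (φ • h : L2)⟫_ℂ * conj (chi x) + ⟪g, (φ • h : L2)⟫_ℂ +
      ⟪shift 1 g, (φ • h : L2)⟫_ℂ * chi x
  have hchi := continuous_chi
  have hP : (fun x => conj (P x) * P x) =
      fun x => (c * chi x + conj (c * chi x)) * (d * chi x + conj (d * chi x)) := by
    refine (Continuous.ae_eq_iff_eq arc (by fun_prop) (by fun_prop)).1 ?_
    filter_upwards [hg.conj_mul_symbol_smul_ae_eq hh, hg.modulusIdentity, hh.modulusIdentity,
      coeFn_symbol_smul φ h] with x hPx hgx hhx hφx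
    rw [← hgx, ← hhx, show P x = _ from hPx.symm, hφx]
    simp only [map_mul, Complex.conj_conj, Complex.conj_ofReal, Complex.ofReal_mul,
      Complex.ofReal_pow, ← Complex.conj_mul']
    ring
  have hroot {x : UnitAddCircle} (hx : c * chi x + conj (c * chi x) = 0) : P x = 0 := by
    have hPx := congrFun hP x
    rw [hx, zero_mul, mul_eq_zero, map_eq_zero, or_self] at hPx
    exact hPx
  obtain ⟨x, hx⟩ := exists_mul_chi_add_conj_eq_zero c
  obtain ⟨y, hy⟩ := exists_chi_eq (z := -chi x) (by rw [norm_neg, norm_chi])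
  have hPx := hroot hx
  have hPy := hroot (x := y) (by rw [hy, mul_neg, map_neg, ← neg_add, hx, neg_zero])
  simp only [P, hy, map_neg] at hPx hPy
  linear_combination (hPx + hPy) / 2

end CrossTerm

/-- The functions that are in the kernel of some `T_φ^𝒱`. That their sums have the same property is
the content of `IsKernelFunction.inner_eq_zero`. -/
def kernelFunctions (φ : RealLinf) : Submodule ℂ L2 where
  carrier := {g | IsKernelFunction φ g}
  zero_mem' := by
    have hzero : (φ • (0 : L2) : L2) = 0 := by simp
    exact ⟨zero_mem _, by rw [hzero, inner_zero_right], fun m _ => by rw [hzero, inner_zero_right]⟩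
  add_mem' := by
    intro g h hg hh
    refine ⟨add_mem hg.mem_H2 hh.mem_H2, ?_, fun m hm => ?_⟩
    · simp only [Lp.add_smul, inner_add_left, inner_add_right, hg.inner_self, hh.inner_self,
        hg.inner_eq_zero hh, hh.inner_eq_zero hg, add_zero]
    · rw [Lp.add_smul, inner_add_right, hg.inner_shift_two m hm, hh.inner_shift_two m hm, add_zero]
  smul_mem' := by
    intro a g hg
    refine ⟨H2.smul_mem a hg.mem_H2, ?_, fun m hm => ?_⟩
    · rw [mul_smul_L2, inner_smul_right, inner_smul_left, hg.inner_self, mul_zero, mul_zero]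
    · rw [mul_smul_L2, inner_smul_right, hg.inner_shift_two m hm, mul_zero]

theorem toeplitzKernel_le_kernelFunctions (φ : RealLinf) {V : Submodule ℂ L2}
    (hV : V ≤ affinePolys) : toeplitzKernel φ V ≤ kernelFunctions φ := by
  intro g hg
  obtain ⟨hgV, horth⟩ := mem_toeplitzKernel_iff_inner.1 hg
  exact ⟨(mem_H2V.1 hgV).1, horth g hgV, fun m hm => horth _ (shift_mem_H2V hV hm le_rfl)⟩

theorem exists_mem_H2_ae_eq_conj_wanderingVector_mul (g : L2) :
    ∃ h ∈ H2, ∀ᵐ x ∂arc, h x = conj (wanderingVector g x) * g x := by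
  have hmem : MemLp (fun x => conj (wanderingVector g x) * g x) 2 arc := by
    refine (Lp.memLp g).of_le_mul (integrable_conj_mul _ g).1 (c := ‖wanderingVector g‖) ?_
    filter_upwards [norm_wanderingVector_ae_eq g] with x hx
    rw [norm_mul, RCLike.norm_conj, hx]
  refine ⟨hmem.toLp, fun n hn => ?_, hmem.coeFn_toLp⟩
  rw [fourierCoeff_congr_ae hmem.coeFn_toLp, ← inner_shift_left, ← neg_neg n, ← inner_shift_right]
  exact inner_wanderingVector_shift (self_mem_cyclicSubspace g) (by lia)

theorem fourierCoeff_eq_zero_of_recurrence {f : L2} {c : ℂ} (hc : c ≠ 0)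
    (h : ∀ n : ℤ, 2 ≤ n → c * fourierCoeff f (n - 1) + conj c * fourierCoeff f (n + 1) = 0)
    {n : ℤ} (hn : 1 ≤ n) : fourierCoeff f n = 0 := by
  have hu : (fun k : ℕ => fourierCoeff f ((k + 1 : ℕ) : ℤ)) = 0 := by
    refine eq_zero_of_norm_add_eq_of_tendsto_zero two_pos (fun k => ?_)
      ((tendsto_fourierCoeff_atTop f).comp (tendsto_add_atTop_nat 1))
    have hk := congrArg norm (eq_neg_of_add_eq_zero_left (h (k + 2) (by lia)))
    rw [norm_neg, norm_mul, norm_mul, RCLike.norm_conj, show (k : ℤ) + 2 - 1 = (k + 1 : ℕ) by lia,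
      show (k : ℤ) + 2 + 1 = (k + 2 + 1 : ℕ) by lia] at hk
    exact (mul_left_cancel₀ (norm_ne_zero_iff.2 hc) hk).symm
  obtain ⟨k, rfl⟩ : ∃ k : ℕ, n = (k + 1 : ℕ) := ⟨(n - 1).toNat, by lia⟩
  exact congrFun hu k

namespace IsKernelFunction

variable {φ : RealLinf} {g : L2} (hg : IsKernelFunction φ g)
include hg

-- The pairing of `φ g` with `χⁿ conj θ g`, where `θ` is the wandering vector, is a Fourier
-- coefficient of `φ |g|² θ`.
theorem fourierCoeff_wanderingVector_eq_zero (hφ : φ ≠ 0) (hg0 : g ≠ 0) {n : ℤ} (hn : 1 ≤ n) :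
    fourierCoeff (wanderingVector g) n = 0 := by
  obtain ⟨h, hh, hhθ⟩ := exists_mem_H2_ae_eq_conj_wanderingVector_mul g
  have hid := hg.modulusIdentity
  refine fourierCoeff_eq_zero_of_recurrence (hid.ne_zero hφ hg.mem_H2 hg0) (fun n hn => ?_) hn
  rw [← hid.fourierCoeff_mul, ← hg.inner_shift_symbol_smul_eq_zero hh hn, inner_shift_left]
  refine congrFun (fourierCoeff_congr_ae ?_) n
  filter_upwards [hhθ] with x hx
  rw [hx, map_mul, Complex.conj_conj]
  ring

theorem fourierLp_zero_mem_cyclicSubspace (hφ : φ ≠ 0) (hg0 : g ≠ 0) :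
    fourierLp (T := 1) 2 0 ∈ cyclicSubspace g := by
  set θ := wanderingVector g
  have hθ : θ = fourierCoeff θ 0 • fourierLp (T := 1) 2 0 := by
    refine ext_fourierCoeff fun n => ?_
    rw [← coeffCLM_apply n (_ • _), map_smul, coeffCLM_apply, fourierCoeff_fourierLp, smul_eq_mul]
    rcases lt_trichotomy n 0 with hn | rfl | hn
    · rw [if_neg hn.ne, mul_zero]
      exact fourierCoeff_eq_zero_of_mem_cyclicSubspace hg.mem_H2 (wanderingVector_mem g) hn
    · rw [if_pos rfl, mul_one]
    · rw [if_neg hn.ne', mul_zero]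
      exact hg.fourierCoeff_wanderingVector_eq_zero hφ hg0 hn
  have hθ0 : fourierCoeff θ 0 ≠ 0 := fun h0 =>
    wanderingVector_ne_zero hg.mem_H2 hg0 (hθ.trans (by rw [h0, zero_smul]))
  exact (Submodule.smul_mem_iff _ hθ0).1 (hθ ▸ wanderingVector_mem g)

theorem isOuter (hφ : φ ≠ 0) (hg0 : g ≠ 0) : IsOuter g := by
  refine isOuter_of_H2_le_cyclicSubspace hg.mem_H2
    (H2_le_of_fourierLp_mem (isClosed_cyclicSubspace g) fun n => ?_)
  rw [← add_zero (n : ℤ), ← shift_fourierLp]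
  exact cyclicSubspace_shift_le g n
    (shift_mem_cyclicSubspace_shift (hg.fourierLp_zero_mem_cyclicSubspace hφ hg0) n)

end IsKernelFunction

theorem rank_kernelFunctions_le_one {φ : RealLinf} (hφ : φ ≠ 0) :
    Module.rank ℂ (kernelFunctions φ) ≤ 1 := by
  let evalZero : kernelFunctions φ →ₗ[ℂ] ℂ := (coeffCLM 0).toLinearMap.domRestrict _
  have hinj : Function.Injective evalZero := by
    refine (injective_iff_map_eq_zero evalZero).2 fun g h0 => ?_
    by_contra hg0
    have hout := IsKernelFunction.isOuter g.2 hφ (Submodule.coe_eq_zero.not.2 hg0)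
    exact hout.fourierCoeff_zero_ne_zero ((coeffCLM_apply 0 g).symm.trans h0)
  exact (evalZero.rank_le_of_injective hinj).trans_eq (Module.rank_self ℂ)

/-! ### The space determined by a kernel function -/

theorem determinedSpace_eq_span {w₀ : ℂ} (hw₀ : w₀ ≠ 0) (w₁ : ℂ) : determinedSpace w₀ w₁ =
    ℂ ∙ (conj w₁ • fourierLp (T := 1) 2 0 - conj w₀ • fourierLp (T := 1) 2 1) := by
  have hw₀' : conj w₀ ≠ 0 := (map_ne_zero _).2 hw₀
  have hinner (a b : ℂ) : ⟪w₀ • fourierLp (T := 1) 2 0 + w₁ • fourierLp (T := 1) 2 1,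
      a • fourierLp (T := 1) 2 0 + b • fourierLp (T := 1) 2 1⟫_ℂ = conj w₀ * a + conj w₁ * b := by
    simp only [inner_add_right, inner_smul_right, inner_affine, fourierCoeff_fourierLp, reduceIte,
      zero_ne_one, one_ne_zero, mul_one, mul_zero, add_zero, zero_add]
    ring
  ext v
  rw [determinedSpace, Submodule.mem_inf, Submodule.mem_orthogonal_singleton_iff_inner_right,
    mem_affinePolys, Submodule.mem_span_singleton]
  constructor
  · rintro ⟨⟨a, b, rfl⟩, hab⟩
    rw [hinner] at hab
    have ha : a = -b / conj w₀ * conj w₁ := by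
      field_simp
      linear_combination hab
    have hb : b = b / conj w₀ * conj w₀ := by field_simp
    refine ⟨-b / conj w₀, ?_⟩
    rw [smul_sub, smul_smul, smul_smul, ← ha, neg_div, neg_mul, ← hb, neg_smul, sub_neg_eq_add]
  · rintro ⟨t, rfl⟩
    have hsplit : t • (conj w₁ • fourierLp (T := 1) 2 0 - conj w₀ • fourierLp (T := 1) 2 1) =
        (t * conj w₁) • fourierLp (T := 1) 2 0 + (-(t * conj w₀)) • fourierLp (T := 1) 2 1 := by
      module
    rw [hsplit]
    exact ⟨⟨_, _, rfl⟩, by rw [hinner]; ring⟩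

theorem mem_H2V_determinedSpace {w₀ : ℂ} (hw₀ : w₀ ≠ 0) {w₁ : ℂ} {k : L2} :
    k ∈ H2V (determinedSpace w₀ w₁) ↔
      k ∈ H2 ∧ w₁ * fourierCoeff k 0 = w₀ * fourierCoeff k 1 := by
  rw [determinedSpace_eq_span hw₀, H2V, Submodule.mem_inf,
    Submodule.mem_orthogonal_singleton_iff_inner_right, sub_eq_add_neg, ← neg_smul, inner_affine,
    map_neg, Complex.conj_conj, Complex.conj_conj, neg_mul, ← sub_eq_add_neg, sub_eq_zero]

theorem le_determinedSpace {V : Submodule ℂ L2} (hV : V ≤ affinePolys) {g : L2}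
    (hg : g ∈ H2V V) : V ≤ determinedSpace (fourierCoeff g 0) (fourierCoeff g 1) := by
  intro v hv
  obtain ⟨a, b, rfl⟩ := mem_affinePolys.1 (hV hv)
  refine ⟨hV hv, Submodule.mem_orthogonal_singleton_iff_inner_left.2 ?_⟩
  rw [← (mem_H2V.1 hg).2 _ hv, inner_affine, inner_affine]
  simp only [← coeffCLM_apply, map_add, map_smul]
  simp only [coeffCLM_apply, fourierCoeff_fourierLp]
  norm_num

namespace IsKernelFunction

variable {φ : RealLinf} {g : L2} (hg : IsKernelFunction φ g)
include hg

theorem mem_toeplitzKernel_determinedSpace (h0 : fourierCoeff g 0 ≠ 0) :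
    g ∈ toeplitzKernel φ (determinedSpace (fourierCoeff g 0) (fourierCoeff g 1)) := by
  refine mem_toeplitzKernel_iff_inner.2 ⟨(mem_H2V_determinedSpace h0).2
    ⟨hg.mem_H2, mul_comm _ _⟩, fun k hk => ?_⟩
  obtain ⟨hkH2, hrel⟩ := (mem_H2V_determinedSpace h0).1 hk
  set r := fourierCoeff k 0 / fourierCoeff g 0
  have hcoeff (n : ℤ) : fourierCoeff (k - r • g) n = fourierCoeff k n - r * fourierCoeff g n := by
    simp only [← coeffCLM_apply, map_sub, map_smul, smul_eq_mul]
  have hm : shift (-2) (k - r • g) ∈ H2 := fun n hn => by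
    rw [fourierCoeff_shift, hcoeff]
    obtain hn | hn | hn : n - -2 < 0 ∨ n - -2 = 0 ∨ n - -2 = 1 := by lia
    · rw [hkH2 _ hn, hg.mem_H2 _ hn, mul_zero, sub_zero]
    · rw [hn, div_mul_cancel₀ _ h0, sub_self]
    · rw [hn, div_mul_eq_mul_div, sub_eq_zero, eq_div_iff h0]
      linear_combination -hrel
  have hsplit : k = shift 2 (shift (-2) (k - r • g)) + r • g := by
    rw [shift_shift, add_neg_cancel, shift_zero, sub_add_cancel]
  rw [hsplit, inner_add_left, inner_smul_left, hg.inner_self, hg.inner_shift_two _ hm, mul_zero,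
    add_zero]

-- If `𝒱 = 0` then `φ g` is also orthogonal to `χ g`, so that `φ |g|² = 0`.
theorem ne_bot_of_mem_toeplitzKernel (hφ : φ ≠ 0) (hg0 : g ≠ 0) {V : Submodule ℂ L2}
    (hgV : g ∈ toeplitzKernel φ V) : V ≠ ⊥ := by
  rintro rfl
  refine hg.modulusIdentity.ne_zero hφ hg.mem_H2 hg0
    ((mem_toeplitzKernel_iff_inner.1 hgV).2 _ (mem_H2V.2 ⟨shift_mem_H2 hg.mem_H2 zero_le_one, ?_⟩))
  rintro v rfl
  exact inner_zero_left _

theorem mem_toeplitzKernel_iff (hφ : φ ≠ 0) (hg0 : g ≠ 0) {V : Submodule ℂ L2}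
    (hV : V ≤ affinePolys) :
    g ∈ toeplitzKernel φ V ↔ V = determinedSpace (fourierCoeff g 0) (fourierCoeff g 1) := by
  have h0 := (hg.isOuter hφ hg0).fourierCoeff_zero_ne_zero
  refine ⟨fun hgV => ?_, fun h => h ▸ hg.mem_toeplitzKernel_determinedSpace h0⟩
  have hVbot := hg.ne_bot_of_mem_toeplitzKernel hφ hg0 hgV
  have hle := le_determinedSpace hV (mem_toeplitzKernel_iff_inner.1 hgV).1
  rw [determinedSpace_eq_span h0] at hle ⊢
  refine ((nonzero_span_atom _ fun h => hVbot ?_).le_iff_eq hVbot).1 hle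
  rwa [h, Submodule.span_zero_singleton, le_bot_iff] at hle

end IsKernelFunction

section Eigenvalue

variable {φ : RealLinf} {V W : Submodule ℂ L2}

theorem exists_ne_zero_mem_toeplitzKernel (h : Module.End.HasEigenvalue (toeplitz φ V) 0) :
    ∃ g ∈ toeplitzKernel φ V, g ≠ 0 := by
  obtain ⟨g, hg⟩ := h.exists_hasEigenvector
  refine ⟨g, mem_toeplitzKernel.2 ⟨g.2, ?_⟩, Submodule.coe_eq_zero.not.2 hg.2⟩
  simpa using hg.apply_eq_smul

theorem eq_of_hasEigenvalue_zero (hφ : φ ≠ 0) (hV : V ≤ affinePolys) (hW : W ≤ affinePolys)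
    (hVev : Module.End.HasEigenvalue (toeplitz φ V) 0)
    (hWev : Module.End.HasEigenvalue (toeplitz φ W) 0) : V = W := by
  obtain ⟨k, hk, hspan⟩ := rank_submodule_le_one_iff _ |>.1 (rank_kernelFunctions_le_one hφ)
  have hdet {U : Submodule ℂ L2} (hU : U ≤ affinePolys)
      (hUev : Module.End.HasEigenvalue (toeplitz φ U) 0) :
      U = determinedSpace (fourierCoeff k 0) (fourierCoeff k 1) := by
    obtain ⟨g, hg, hg0⟩ := exists_ne_zero_mem_toeplitzKernel hUev
    obtain ⟨a, rfl⟩ :=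
      Submodule.mem_span_singleton.1 (hspan (toeplitzKernel_le_kernelFunctions φ hU hg))
    obtain ⟨ha, hk0⟩ := smul_ne_zero_iff.1 hg0
    exact (IsKernelFunction.mem_toeplitzKernel_iff hk hφ hk0 hU).1
      ((Submodule.smul_mem_iff _ ha).1 hg)
  rw [hdet hV hVev, hdet hW hWev]

theorem rank_eigenspace_zero_le_one (hφ : φ ≠ 0) (hV : V ≤ affinePolys) :
    Module.rank ℂ (Module.End.eigenspace (toeplitz φ V) 0) ≤ 1 := by
  rw [Module.End.eigenspace_zero]
  calc Module.rank ℂ (LinearMap.ker (toeplitz φ V)) = Module.rank ℂ (toeplitzKernel φ V) :=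
        (Submodule.equivMapOfInjective _ (H2V V).injective_subtype _).rank_eq
    _ ≤ Module.rank ℂ (kernelFunctions φ) :=
        Submodule.rank_mono (toeplitzKernel_le_kernelFunctions φ hV)
    _ ≤ 1 := rank_kernelFunctions_le_one hφ

end Eigenvalue

end NeilToeplitz

end

theorem theorem3p1 (φ : NeilToeplitz.RealLinf) (hφ : φ ≠ 0) :
    -- every nonzero element of the kernel is outer and satisfies the identity
    (∀ V : Submodule ℂ NeilToeplitz.L2, V ≤ NeilToeplitz.affinePolys →
      ∀ g : NeilToeplitz.H2V V, g ≠ 0 → NeilToeplitz.toeplitz φ V g = 0 →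
        NeilToeplitz.IsOuter (g : NeilToeplitz.L2) ∧
          ∃ c : ℂ, NeilToeplitz.ModulusIdentity φ (g : NeilToeplitz.L2) c) ∧
    -- conversely, an outer function with the identity is in the kernel for exactly one space
    (∀ (c : ℂ) (g : NeilToeplitz.L2), NeilToeplitz.IsOuter g →
      NeilToeplitz.ModulusIdentity φ g c →
        ∀ V : Submodule ℂ NeilToeplitz.L2, V ≤ NeilToeplitz.affinePolys →
          ((∃ hg : g ∈ NeilToeplitz.H2V V, NeilToeplitz.toeplitz φ V ⟨g, hg⟩ = 0) ↔
            V = NeilToeplitz.determinedSpace (NeilToeplitz.toDisc g 0)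
              (deriv (NeilToeplitz.toDisc g) 0))) ∧
    -- at most one space gives the eigenvalue `0`
    (∀ V W : Submodule ℂ NeilToeplitz.L2,
      V ≤ NeilToeplitz.affinePolys → W ≤ NeilToeplitz.affinePolys →
        Module.End.HasEigenvalue (NeilToeplitz.toeplitz φ V) 0 →
          Module.End.HasEigenvalue (NeilToeplitz.toeplitz φ W) 0 → V = W) ∧
    -- the eigenspace has dimension at most one
    (∀ V : Submodule ℂ NeilToeplitz.L2, V ≤ NeilToeplitz.affinePolys →
      Module.rank ℂ (Module.End.eigenspace (NeilToeplitz.toeplitz φ V) 0) ≤ 1) := by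
  refine ⟨fun V hV g hg0 hT => ?_, fun c g hg hid V hV => ?_,
    fun V W hV hW => NeilToeplitz.eq_of_hasEigenvalue_zero hφ hV hW,
    fun V hV => NeilToeplitz.rank_eigenspace_zero_le_one hφ hV⟩
  · have hker : NeilToeplitz.IsKernelFunction φ g :=
      NeilToeplitz.toeplitzKernel_le_kernelFunctions φ hV
        (NeilToeplitz.mem_toeplitzKernel.2 ⟨g.2, hT⟩)
    exact ⟨hker.isOuter hφ (Submodule.coe_eq_zero.not.2 hg0), _, hker.modulusIdentity⟩
  · rw [NeilToeplitz.toDisc_zero, NeilToeplitz.deriv_toDisc_zero,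
      ← NeilToeplitz.mem_toeplitzKernel]
    exact (hg.isKernelFunction hid).mem_toeplitzKernel_iff hφ hg.ne_zero hV
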